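/- Let $A\in\mathbb{R}^{m\times n}$ have rows $a_1^T,\dots,a_m^T$, let $b\in\mathbb{R}^m$ be in the range of $A$, let $\lambda>0$, and let $p_1,\dots,p_m>0$ with $\sum_i p_i=1$. Write $\|\cdot\|$ for the Euclidean norm, $f(x)=\lambda\|x\|_1+\tfrac12\|x\|^2$, $f^*(v)=\sup_{x\in\mathbb{R}^n}\big(\langle v,x\rangle-f(x)\big)$, and let $S_\lambda$ act componentwise by $S_\lambda(x)=\max\{|x|-\lambda,0\}\cdot\operatorname{sign}(x)$. Then the problem $$\min_{x\in\mathbb{R}^n}\ \lambda\|x\|_1+\tfrac12\|x\|^2\quad\text{s.t.}\quad Ax=b$$ has a unique solution $\hat x$, and both of the following methods, started at $x_0=x_0^*=0$, converge to $\hat x$ in expectation, i.e. $\mathbb{E}\|x_k-\hat x\|\to0$. (RSK, the Randomized Sparse Kaczmarz method) In step $k=0,1,2,\dots$ draw $i_k\in\{1,\dots,m\}$ with $\mathbb{P}(i_k=i)=p_i$, independently of the earlier draws, and set $$x_{k+1}^*=x_k^*-\frac{\langle a_{i_k},x_k\rangle-b_{i_k}}{\|a_{i_k}\|^2}\,a_{i_k},\qquad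 x_{k+1}=S_\lambda(x_{k+1}^*),$$ where the step is $x_{k+1}^*=x_k^*$ if $a_{i_k}=0$. (ERSK, the Exact-Step Randomized Sparse Kaczmarz method) In step $k$ draw $i_k$ with $\mathbb{P}(i_k=i)=p_i$, independently of the earlier draws and step sizes, and set $$t_k\in\operatorname*{argmin}_{t\in\mathbb{R}}\big(f^*(x_k^*-t\,a_{i_k})+t\,b_{i_k}\big),\qquad x_{k+1}^*=x_k^*-t_k\,a_{i_k},\qquad x_{k+1}=S_\lambda(x_{k+1}^*).$$ Here a minimizer always exists, and any (measurable) choice of minimizers is allowed. The rate is linear: for each of the two methods there are constants $q\in(0,1)$ and $c>0$, depending only on $A,b,\lambda$ and $(p_i)$, such that for all $k\ge0$ $$\mathbb{E}\,\|x_k-\hat x\|\le c\,q^{k/2}.$$ -/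

import Mathlib

universe u

open MeasureTheory ProbabilityTheory Filter Topology

noncomputable section

namespace SparseKaczmarz

/-- `ℝⁿ` with the Euclidean norm. -/
abbrev E (n : ℕ) : Type := EuclideanSpace ℝ (Fin n)

/-- The `i`-th row `a_i` of `A`, as a vector of `ℝⁿ`. -/
def row {m n : ℕ} (A : Matrix (Fin m) (Fin n) ℝ) (i : Fin m) : E n :=
  WithLp.toLp 2 (A i)

/-- Soft shrinkage, componentwise `max (|x_j| - lam) 0 * sign x_j`. -/
def softShrink {n : ℕ} (lam : ℝ) (x : E n) : E n :=
  WithLp.toLp 2 (fun j => max (|x j| - lam) 0 * Real.sign (x j))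

/-- The objective `f x = lam * ‖x‖₁ + (1/2) * ‖x‖₂²`. -/
def objective {n : ℕ} (lam : ℝ) (x : E n) : ℝ :=
  lam * (∑ j, |x j|) + (1 / 2) * ‖x‖ ^ 2

/-- The convex conjugate `f* v = sup_x (⟨v, x⟩ - f x)`. It is used only for the strongly convex
`objective lam`, for which the supremum is over a set that is bounded above. -/
def conjugate {n : ℕ} (f : E n → ℝ) (v : E n) : ℝ :=
  ⨆ x : E n, (inner ℝ v x - f x)

/-- `x` solves: minimize `lam * ‖x‖₁ + (1/2) * ‖x‖₂²` subject to `A x = b`. -/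
def IsSolution {m n : ℕ} (A : Matrix (Fin m) (Fin n) ℝ) (b : Fin m → ℝ) (lam : ℝ)
    (x : E n) : Prop :=
  A.mulVec x = b ∧ ∀ y : E n, A.mulVec y = b → objective lam x ≤ objective lam y

/-- The dual iterates `x*_k` of the Randomized Sparse Kaczmarz method along the sequence `i` of
chosen row indices. If the chosen row is zero (then `b_i = 0` in a consistent system), division by
zero returns zero and the step leaves the iterate unchanged. -/
def rskDual {m n : ℕ} (A : Matrix (Fin m) (Fin n) ℝ) (b : Fin m → ℝ) (lam : ℝ)
    (i : ℕ → Fin m) : ℕ → E n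
  | 0 => 0
  | k + 1 =>
    rskDual A b lam i k -
      ((inner ℝ (row A (i k)) (softShrink lam (rskDual A b lam i k)) - b (i k))
        / ‖row A (i k)‖ ^ 2) • row A (i k)

/-- The iterates `x_k = S_lam (x*_k)` of the Randomized Sparse Kaczmarz method
(in particular `x_0 = 0`). -/
def rsk {m n : ℕ} (A : Matrix (Fin m) (Fin n) ℝ) (b : Fin m → ℝ) (lam : ℝ)
    (i : ℕ → Fin m) (k : ℕ) : E n :=
  softShrink lam (rskDual A b lam i k)

/-- The dual iterates `x*_{k+1} = x*_k - t_k a_{i_k}`, `x*_0 = 0`, along the row indices `i` and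
the step sizes `t`. -/
def stepDual {m n : ℕ} (A : Matrix (Fin m) (Fin n) ℝ) (i : ℕ → Fin m) (t : ℕ → ℝ) : ℕ → E n
  | 0 => 0
  | k + 1 => stepDual A i t k - t k • row A (i k)

/-- `t` is an exact step size at the dual point `v` for the row `j`: it minimizes
`t ↦ f* (v - t a_j) + t b_j` over the reals. -/
def IsExactStep {m n : ℕ} (A : Matrix (Fin m) (Fin n) ℝ) (b : Fin m → ℝ) (lam : ℝ)
    (v : E n) (j : Fin m) (t : ℝ) : Prop :=
  ∀ s : ℝ, conjugate (objective lam) (v - t • row A j) + t * b j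
    ≤ conjugate (objective lam) (v - s • row A j) + s * b j

/-- `i` and `t` are the row indices and step sizes of a run of the Exact-Step Randomized Sparse
Kaczmarz method: every `t k` is an exact step size at the current dual iterate (minimizers need
not be unique; any may be taken). -/
def IsErskRun {m n : ℕ} (A : Matrix (Fin m) (Fin n) ℝ) (b : Fin m → ℝ) (lam : ℝ)
    (i : ℕ → Fin m) (t : ℕ → ℝ) : Prop :=
  ∀ k, IsExactStep A b lam (stepDual A i t k) (i k) (t k)

/-- The iterates `x_k = S_lam (x*_k)` of the Exact-Step Randomized Sparse Kaczmarz method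
(in particular `x_0 = 0`). -/
def ersk {m n : ℕ} (A : Matrix (Fin m) (Fin n) ℝ) (lam : ℝ)
    (i : ℕ → Fin m) (t : ℕ → ℝ) (k : ℕ) : E n :=
  softShrink lam (stepDual A i t k)

/-- The random points `x k` converge to `xhat` in expectation, with `E ‖x k - xhat‖ ≤ c q^{k/2}`. -/
def ConvergesAtRate {n : ℕ} {Ω : Type u} [MeasurableSpace Ω] (P : Measure Ω)
    (x : ℕ → Ω → E n) (xhat : E n) (c q : ℝ) : Prop :=
  (∀ k, Integrable (fun ω => ‖x k ω - xhat‖) P) ∧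
  (∀ k : ℕ, ∫ ω, ‖x k ω - xhat‖ ∂P ≤ c * q ^ ((k : ℝ) / 2)) ∧
  Tendsto (fun k => ∫ ω, ‖x k ω - xhat‖ ∂P) atTop (𝓝 0)

end SparseKaczmarz

end

/-! The Lyapunov function is the Bregman distance `gap lam x v` = f*(v) - ⟨v, x⟩ + f(x), with f*(v)
= ½‖S v‖² and x the solution; by strong convexity it dominates ½‖S v - x‖². Since f* has the
1-Lipschitz gradient S, a Kaczmarz step along a row lowers it by half the squared normalized
residual (`gap_sub_smul_le`). As b = A x, an exact step minimizes it on the same line, so it does no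
worse.

It remains to bound the gap by the squared residual on the range of Aᵀ (`exists_gap_le_residual`).
Convexity of f* gives gap(Aᵀy) ≤ ⟨A(S Aᵀy - x), y - w⟩ for every w with S Aᵀw = x. These w form a
polyhedron, so Hoffman's bound provides one with ‖y - w‖ ≤ C‖S Aᵀy - x‖ ≤ C√(2 gap), and a square
root of the gap cancels. Averaging over the independent row index then contracts the expected gap by
a fixed factor, and Jensen's inequality passes to the norm, halving the exponent. -/

namespace SparseKaczmarz

/-! ### Hoffman's error bound for polyhedra -/

section Hoffman

variable {V : Type*} [NormedAddCommGroup V] [InnerProductSpace ℝ V] [FiniteDimensional ℝ V]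
  {ι : Type*}

/-- On the polar of a polyhedral cone, the violation of the inequalities defining the cone is
bounded below by a multiple of the norm. -/
theorem exists_mul_norm_le_sum_of_mem_polar (ℓ : ι → V →L[ℝ] ℝ) (I : Finset ι) :
    ∃ c > 0, ∀ u : V, (∀ z, (∀ j ∈ I, ℓ j z ≤ 0) → inner ℝ u z ≤ 0) →
      c * ‖u‖ ≤ ∑ j ∈ I, max (ℓ j u) 0 := by
  set T : Set V := Metric.sphere 0 1 ∩ {u | ∀ z, (∀ j ∈ I, ℓ j z ≤ 0) → inner ℝ u z ≤ 0} with hT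
  have hTc : IsCompact T := by
    refine (isCompact_sphere 0 1).inter_right ?_
    simp only [Set.ofPred_forall]
    exact isClosed_iInter fun z => isClosed_iInter fun _ =>
      isClosed_le (by fun_prop) continuous_const
  have key : ∃ c > 0, ∀ u ∈ T, c ≤ ∑ j ∈ I, max (ℓ j u) 0 := by
    rcases T.eq_empty_or_nonempty with h | h
    · exact ⟨1, one_pos, by simp [h]⟩
    obtain ⟨u, huT, hu⟩ := hTc.exists_isMinOn h (f := fun u => ∑ j ∈ I, max (ℓ j u) 0)
      (Continuous.continuousOn (by fun_prop))
    refine ⟨_, ?_, fun w hw => hu hw⟩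
    -- Zero violation would put `u` in the cone as well as in its polar, so ⟨u, u⟩ ≤ 0 on the unit
    -- sphere.
    by_contra hle
    have h0 : ∑ j ∈ I, max (ℓ j u) 0 = 0 :=
      le_antisymm (not_lt.mp hle) (Finset.sum_nonneg fun _ _ => le_max_right _ _)
    rw [Finset.sum_eq_zero_iff_of_nonneg fun _ _ => le_max_right _ _] at h0
    have h1 := huT.2 u fun j hj => max_eq_right_iff.mp (h0 j hj)
    rw [real_inner_self_eq_norm_sq, mem_sphere_zero_iff_norm.mp huT.1] at h1
    norm_num at h1
  obtain ⟨c, hc, h⟩ := key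
  refine ⟨c, hc, fun u hu => ?_⟩
  rcases eq_or_ne u 0 with rfl | hu0
  · simp
  have hn : 0 < ‖u‖ := norm_pos_iff.mpr hu0
  have := h (‖u‖⁻¹ • u) ⟨by simp [norm_smul, hn.ne'], fun z hz => by
    rw [real_inner_smul_left]
    exact mul_nonpos_of_nonneg_of_nonpos (by positivity) (hu z hz)⟩
  calc c * ‖u‖ ≤ (∑ j ∈ I, max (ℓ j (‖u‖⁻¹ • u)) 0) * ‖u‖ := by gcongr
    _ = ∑ j ∈ I, max (ℓ j u) 0 := by
      rw [Finset.sum_mul]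
      refine Finset.sum_congr rfl fun j _ => ?_
      rw [max_mul_of_nonneg _ _ hn.le, map_smul, smul_eq_mul, zero_mul]
      congr 1
      field_simp

/-- **Hoffman's error bound**: the distance to a nonempty polyhedron is at most a multiple of the
violation of the inequalities that define it. -/
theorem hoffman_error_bound [Fintype ι] (ℓ : ι → V →L[ℝ] ℝ) (β : ι → ℝ) (hne : ∃ x, ∀ j, ℓ j x ≤ β j) :
    ∃ C ≥ 0, ∀ v, ∃ w, (∀ j, ℓ j w ≤ β j) ∧ ‖v - w‖ ≤ C * ∑ j, max (ℓ j v - β j) 0 := by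
  classical
  choose c hc h using exists_mul_norm_le_sum_of_mem_polar ℓ
  -- The active set at the projection varies with `v`, but there are finitely many candidates; the
  -- sum dominates every constant.
  refine ⟨∑ I, (c I)⁻¹, Finset.sum_nonneg fun I _ => (inv_pos.mpr (hc I)).le, fun v => ?_⟩
  set Q : Set V := {x | ∀ j, ℓ j x ≤ β j} with hQ
  have hQclosed : IsClosed Q := by
    simp only [hQ, Set.ofPred_forall]
    exact isClosed_iInter fun j => isClosed_le (by fun_prop) continuous_const
  have hQconv : Convex ℝ Q := by
    simp only [hQ, Set.ofPred_forall]
    exact convex_iInter fun j => convex_halfSpace_le (ℓ j).isLinear (β j)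
  obtain ⟨w, hwQ, hw⟩ := exists_norm_eq_iInf_of_complete_convex (K := Q) hne
    hQclosed.isComplete hQconv v
  rw [norm_eq_iInf_iff_real_inner_le_zero hQconv hwQ] at hw
  refine ⟨w, hwQ, ?_⟩
  set I : Finset ι := Finset.univ.filter fun j => ℓ j w = β j with hI
  -- Moving from `w` a little along such a `z` stays in the polyhedron, because inactive constraints
  -- are strict; the variational inequality of the projection then applies.
  have hpolar : ∀ z, (∀ j ∈ I, ℓ j z ≤ 0) → inner ℝ (v - w) z ≤ 0 := by
    intro z hz
    have hev : ∀ᶠ ε : ℝ in 𝓝[>] 0, ∀ j, ℓ j (w + ε • z) ≤ β j := by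
      rw [eventually_all]
      intro j
      by_cases hj : ℓ j w = β j
      · filter_upwards [self_mem_nhdsWithin] with ε hε
        have := hz j (by simp [hI, hj])
        rw [map_add, map_smul, hj, smul_eq_mul]
        nlinarith [Set.mem_Ioi.mp hε]
      · have hlt : ℓ j (w + (0 : ℝ) • z) < β j := by
          simpa using lt_of_le_of_ne (hwQ j) hj
        have hcont : Continuous fun ε : ℝ => ℓ j (w + ε • z) := by fun_prop
        exact ((hcont.tendsto 0).eventually_lt_const hlt).filter_mono nhdsWithin_le_nhds
          |>.mono fun _ h => h.le
    obtain ⟨ε, hεQ, hε⟩ := (hev.and self_mem_nhdsWithin).exists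
    have h1 := hw _ hεQ
    rw [add_sub_cancel_left, real_inner_smul_right] at h1
    exact nonpos_of_mul_nonpos_right h1 hε
  have h1 := h I (v - w) hpolar
  have h2 : ∑ j ∈ I, max (ℓ j (v - w)) 0 ≤ ∑ j, max (ℓ j v - β j) 0 := by
    calc _ = ∑ j ∈ I, max (ℓ j v - β j) 0 := Finset.sum_congr rfl fun j hj => by
            rw [map_sub, (Finset.mem_filter.mp hj).2]
      _ ≤ _ := Finset.sum_le_univ_sum_of_nonneg fun _ => le_max_right _ _
  have hs : 0 ≤ ∑ j, max (ℓ j v - β j) 0 := Finset.sum_nonneg fun _ _ => le_max_right _ _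
  calc ‖v - w‖ = (c I)⁻¹ * (c I * ‖v - w‖) := by field_simp [(hc I).ne']
    _ ≤ (c I)⁻¹ * ∑ j, max (ℓ j v - β j) 0 :=
      mul_le_mul_of_nonneg_left (h1.trans h2) (inv_pos.mpr (hc I)).le
    _ ≤ _ := mul_le_mul_of_nonneg_right
      (Finset.single_le_sum (f := fun I => (c I)⁻¹) (fun I _ => (inv_pos.mpr (hc I)).le)
        (Finset.mem_univ I)) hs

end Hoffman

/-! ### Soft shrinkage on the line -/

section Scalar

/-- Soft shrinkage on the real line. -/
noncomputable def shrink (lam v : ℝ) : ℝ := max (|v| - lam) 0 * Real.sign v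

variable {lam : ℝ}

theorem shrink_eq_sub_clamp (hlam : 0 < lam) (v : ℝ) :
    shrink lam v = v - max (-lam) (min v lam) := by
  unfold shrink
  rcases lt_trichotomy v 0 with h | rfl | h
  · rw [Real.sign_of_neg h, abs_of_neg h]
    rcases le_total v (-lam) with h1 | h1
    · rw [max_eq_left (by linarith), min_eq_left (by linarith), max_eq_left h1]; ring
    · rw [max_eq_right (by linarith), min_eq_left (by linarith), max_eq_right h1]; ring
  · simp [hlam.le]
  · rw [Real.sign_of_pos h, abs_of_pos h]
    rcases le_total v lam with h1 | h1
    · rw [max_eq_right (by linarith), min_eq_left h1, max_eq_right (by linarith)]; ring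
    · rw [max_eq_left (by linarith), min_eq_right h1, max_eq_right (by linarith)]; ring

theorem continuous_shrink (hlam : 0 < lam) : Continuous (shrink lam) := by
  rw [funext (shrink_eq_sub_clamp hlam)]
  fun_prop

theorem shrink_neg (v : ℝ) : shrink lam (-v) = -shrink lam v := by
  simp [shrink, Real.sign_neg]

/-- The value `s` of the shrinkage at `v` is determined by the position of `v`. -/
theorem shrink_cases (hlam : 0 < lam) (v : ℝ) :
    (0 < shrink lam v ∧ v = shrink lam v + lam) ∨ (shrink lam v < 0 ∧ v = shrink lam v - lam) ∨
      (shrink lam v = 0 ∧ -lam ≤ v ∧ v ≤ lam) := by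
  rw [shrink_eq_sub_clamp hlam]
  rcases lt_or_ge v (-lam) with h | h
  · right; left
    rw [min_eq_left (by linarith), max_eq_left h.le]
    constructor <;> linarith
  rcases le_or_gt v lam with h1 | h1
  · right; right
    rw [min_eq_left h1, max_eq_right h]
    exact ⟨sub_self v, h, h1⟩
  · left
    rw [min_eq_right h1.le, max_eq_right (by linarith)]
    constructor <;> linarith

/-- With `sub_shrink_mul_shrink`, this makes `v - shrink lam v` a subgradient of lam|·| at `shrink
lam v`. -/
theorem abs_sub_shrink_le (hlam : 0 < lam) (v : ℝ) : |v - shrink lam v| ≤ lam := by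
  rw [abs_le]
  rcases shrink_cases hlam v with h | h | h <;> constructor <;> linarith

theorem sub_shrink_mul_shrink (hlam : 0 < lam) (v : ℝ) :
    (v - shrink lam v) * shrink lam v = lam * |shrink lam v| := by
  rcases shrink_cases hlam v with h | h | h
  · rw [abs_of_pos h.1]; nlinarith
  · rw [abs_of_neg h.1]; nlinarith
  · simp [h.1]

theorem mul_add_sq_sub_shrink_le (hlam : 0 < lam) (v x : ℝ) :
    v * x + 1 / 2 * (x - shrink lam v) ^ 2 ≤
      1 / 2 * shrink lam v ^ 2 + (lam * |x| + 1 / 2 * x ^ 2) := by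
  have h : (v - shrink lam v) * x ≤ lam * |x| :=
    (le_abs_self _).trans (by rw [abs_mul]; gcongr; exact abs_sub_shrink_le hlam v)
  nlinarith

theorem mul_shrink_eq (hlam : 0 < lam) (v : ℝ) :
    v * shrink lam v = 1 / 2 * shrink lam v ^ 2 +
      (lam * |shrink lam v| + 1 / 2 * shrink lam v ^ 2) := by
  linarith [sub_shrink_mul_shrink hlam v]

/-- Shrinking `v + w` removes as much of lam as possible, hence at least the part `v - shrink lam
v`. This is the source of the smoothness of f*. -/
theorem shrink_add_sq_le (hlam : 0 < lam) (v w : ℝ) :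
    shrink lam (v + w) ^ 2 ≤ (shrink lam v + w) ^ 2 := by
  have h1 := abs_le.mp (abs_sub_shrink_le hlam v)
  rw [sq_le_sq]
  rcases shrink_cases hlam (v + w) with h | h | h
  · rw [abs_of_pos h.1]; exact le_trans (by linarith) (le_abs_self _)
  · rw [abs_of_neg h.1]; exact le_trans (by linarith) (neg_le_abs _)
  · simp [h.1]

/-- The right end point of the subdifferential of `lam * |x| + x ^ 2 / 2` at `x`. -/
noncomputable def subdiffMax (lam x : ℝ) : ℝ := if x < 0 then x - lam else x + lam

/-- The left end point of the subdifferential is `-subdiffMax lam (-x)`, so the fibres of shrinkage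
are cut out by linear inequalities in `v`. -/
theorem shrink_eq_iff (hlam : 0 < lam) (v x : ℝ) :
    shrink lam v = x ↔ v ≤ subdiffMax lam x ∧ -v ≤ subdiffMax lam (-x) := by
  unfold subdiffMax
  constructor
  · rintro rfl
    rcases shrink_cases hlam v with h | h | h <;> constructor <;> split_ifs <;> linarith
  · rintro ⟨h1, h2⟩
    rcases shrink_cases hlam v with h | h | h <;> split_ifs at h1 h2 <;> linarith

/-- The only loss is the jump of 2 lam when `x < 0` but the shrinkage is nonnegative; there the
shrinkages differ by at least |x|. At `x = 0` there is no jump, in accord with the quotient being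
zero by convention. -/
theorem max_sub_subdiffMax_le (hlam : 0 < lam) (v x : ℝ) :
    max (v - subdiffMax lam x) 0 ≤ (1 + 2 * lam / |x|) * |shrink lam v - x| := by
  have hC : 0 ≤ 2 * lam / |x| := by positivity
  have h1 := abs_le.mp (abs_sub_shrink_le hlam v)
  have h2 := le_abs_self (shrink lam v - x)
  have h3 := abs_nonneg (shrink lam v - x)
  have h4 := mul_nonneg hC h3
  refine max_le ?_ (by positivity)
  unfold subdiffMax
  split_ifs with hx
  · rcases lt_or_ge (shrink lam v) 0 with hs | hs
    · rcases shrink_cases hlam v with h | h | h <;> linarith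
    · have h5 : |x| ≤ |shrink lam v - x| := by rw [abs_of_neg hx]; linarith
      have h6 : 2 * lam ≤ 2 * lam / |x| * |shrink lam v - x| := by
        rw [div_mul_eq_mul_div, le_div_iff₀ (abs_pos.mpr hx.ne)]
        gcongr
      linarith
  · linarith

end Scalar

end SparseKaczmarz

namespace SparseKaczmarz

/-! ### Conjugate and Bregman distance of the objective -/

section Shrinkage

variable {n : ℕ} {lam : ℝ}

theorem continuous_softShrink (hlam : 0 < lam) : Continuous (softShrink lam : E n → E n) := by
  refine (PiLp.continuous_toLp 2 _).comp (continuous_pi fun j => ?_)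
  exact (continuous_shrink hlam).comp (PiLp.continuous_apply 2 _ j)

theorem inner_eq_sum_mul (x y : E n) : inner ℝ x y = ∑ j, x j * y j := by
  simp [PiLp.inner_apply, mul_comm]

theorem norm_sq_eq_sum_sq (x : E n) : ‖x‖ ^ 2 = ∑ j, x j ^ 2 :=
  EuclideanSpace.real_norm_sq_eq x

/-- The Fenchel inequality for `objective lam`, strengthened by strong convexity. -/
theorem inner_add_sq_le (hlam : 0 < lam) (v x : E n) :
    inner ℝ v x + 1 / 2 * ‖x - softShrink lam v‖ ^ 2 ≤
      1 / 2 * ‖softShrink lam v‖ ^ 2 + objective lam x := by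
  simp only [objective, inner_eq_sum_mul, norm_sq_eq_sum_sq, Finset.mul_sum,
    ← Finset.sum_add_distrib]
  exact Finset.sum_le_sum fun j _ => mul_add_sq_sub_shrink_le hlam (v j) (x j)

theorem inner_softShrink (hlam : 0 < lam) (v : E n) :
    inner ℝ v (softShrink lam v) =
      1 / 2 * ‖softShrink lam v‖ ^ 2 + objective lam (softShrink lam v) := by
  simp only [objective, inner_eq_sum_mul, norm_sq_eq_sum_sq, Finset.mul_sum,
    ← Finset.sum_add_distrib]
  exact Finset.sum_congr rfl fun j _ => mul_shrink_eq hlam (v j)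

theorem norm_softShrink_add_sq_le (hlam : 0 < lam) (v w : E n) :
    ‖softShrink lam (v + w)‖ ^ 2 ≤ ‖softShrink lam v + w‖ ^ 2 := by
  simp only [norm_sq_eq_sum_sq]
  exact Finset.sum_le_sum fun j _ => shrink_add_sq_le hlam (v j) (w j)

theorem conjugate_objective (hlam : 0 < lam) (v : E n) :
    conjugate (objective lam) v = 1 / 2 * ‖softShrink lam v‖ ^ 2 := by
  have h : ∀ x : E n, inner ℝ v x - objective lam x ≤ 1 / 2 * ‖softShrink lam v‖ ^ 2 := fun x => by
    nlinarith [inner_add_sq_le hlam v x, sq_nonneg ‖x - softShrink lam v‖]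
  refine le_antisymm (ciSup_le h) ?_
  refine le_trans (le_of_eq ?_) (le_ciSup (f := fun x : E n => inner ℝ v x - objective lam x)
    ⟨_, Set.forall_mem_range.mpr h⟩ (softShrink lam v))
  simp only [inner_softShrink hlam v]
  ring

/-- The Bregman distance between `softShrink lam v` and `x` with respect to `objective lam` and
the subgradient `v`. -/
noncomputable def gap (lam : ℝ) (x v : E n) : ℝ :=
  1 / 2 * ‖softShrink lam v‖ ^ 2 - inner ℝ v x + objective lam x

theorem sq_norm_sub_le_gap (hlam : 0 < lam) (x v : E n) :
    1 / 2 * ‖softShrink lam v - x‖ ^ 2 ≤ gap lam x v := by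
  rw [norm_sub_rev, gap]
  linarith [inner_add_sq_le hlam v x]

theorem gap_nonneg (hlam : 0 < lam) (x v : E n) : 0 ≤ gap lam x v :=
  le_trans (by positivity) (sq_norm_sub_le_gap hlam x v)

theorem continuous_gap (hlam : 0 < lam) (x : E n) : Continuous (gap lam x) := by
  have := continuous_softShrink (n := n) hlam
  unfold gap
  fun_prop

/-- The descent lemma for f*, whose gradient is `softShrink lam`. -/
theorem gap_add_le (hlam : 0 < lam) (x v w : E n) :
    gap lam x (v + w) ≤ gap lam x v + inner ℝ w (softShrink lam v - x) + 1 / 2 * ‖w‖ ^ 2 := by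
  have h := norm_softShrink_add_sq_le hlam v w
  rw [norm_add_sq_real] at h
  rw [gap, gap, inner_add_left, inner_sub_right, real_inner_comm (softShrink lam v) w]
  linarith

/-- The step of length `⟨a, S v - x⟩ / ‖a‖ ^ 2` along `a` decreases the Bregman distance. -/
theorem gap_sub_smul_le (hlam : 0 < lam) (x v a : E n) :
    gap lam x (v - (inner ℝ a (softShrink lam v - x) / ‖a‖ ^ 2) • a) ≤
      gap lam x v - 1 / 2 * (inner ℝ a (softShrink lam v - x) ^ 2 / ‖a‖ ^ 2) := by
  set r := inner ℝ a (softShrink lam v - x) with hr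
  have h := gap_add_le hlam x v (-((r / ‖a‖ ^ 2) • a))
  rw [← sub_eq_add_neg, inner_neg_left, real_inner_smul_left, ← hr, norm_neg, norm_smul, mul_pow,
    Real.norm_eq_abs, sq_abs] at h
  refine h.trans (le_of_eq ?_)
  rcases eq_or_ne a 0 with rfl | ha
  · simp
  · have : ‖a‖ ≠ 0 := norm_ne_zero_iff.mpr ha
    field_simp
    ring

/-- Shrinkage displaces a vector by a bounded amount, so `‖v‖` large forces `‖softShrink lam v - x‖`
large. -/
theorem gap_coercive (hlam : 0 < lam) (x : E n) : Tendsto (gap lam x) (cocompact (E n)) atTop := by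
  have hb : ∀ v : E n, ‖v‖ ≤ ‖softShrink lam v‖ + lam * n := fun v => by
    have h1 : ‖v - softShrink lam v‖ ≤ lam * n := by
      have hcard : (n : ℝ) ≤ (n : ℝ) ^ 2 := by exact_mod_cast Nat.le_self_pow two_ne_zero n
      refine abs_le_of_sq_le_sq' ?_ (by positivity) |>.2
      calc ‖v - softShrink lam v‖ ^ 2 = ∑ j, (v - softShrink lam v) j ^ 2 := norm_sq_eq_sum_sq _
        _ ≤ ∑ _j : Fin n, lam ^ 2 := Finset.sum_le_sum fun j _ =>
          sq_le_sq' (abs_le.mp (abs_sub_shrink_le hlam (v j))).1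
            (abs_le.mp (abs_sub_shrink_le hlam (v j))).2
        _ = lam ^ 2 * n := by simp [mul_comm]
        _ ≤ (lam * n) ^ 2 := by rw [mul_pow]; gcongr
    linarith [norm_le_norm_add_norm_sub' v (softShrink lam v)]
  refine tendsto_atTop_mono (f := fun v => ‖v‖ - lam * n - ‖x‖ - 1 / 2) (fun v => ?_) ?_
  · have h1 := sq_norm_sub_le_gap hlam x v
    have h2 := norm_le_norm_add_norm_sub' (softShrink lam v) x
    nlinarith [hb v, sq_nonneg (‖softShrink lam v - x‖ - 1)]
  · simp only [sub_eq_add_neg]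
    exact tendsto_atTop_add_const_right _ _ (tendsto_atTop_add_const_right _ _
      (tendsto_atTop_add_const_right _ _ (tendsto_norm_cocompact_atTop (E := E n))))

/-- Used twice: on the range of Aᵀ for a dual optimum, and on a line for an exact step. -/
theorem exists_forall_gap_le (hlam : 0 < lam) (x v : E n) (K : Submodule ℝ (E n)) :
    ∃ u ∈ K, ∀ w ∈ K, gap lam x (v + u) ≤ gap lam x (v + w) := by
  have hcont : Continuous fun u => gap lam x (v + u) :=
    (continuous_gap hlam x).comp (continuous_const.add continuous_id)
  have htend : Tendsto (fun u => gap lam x (v + u)) (cocompact (E n)) atTop :=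
    (gap_coercive hlam x).comp (Homeomorph.addLeft v).isClosedEmbedding.tendsto_cocompact
  obtain ⟨u, hu, h⟩ := hcont.continuousOn.exists_isMinOn' (Submodule.closed_of_finiteDimensional K)
    K.zero_mem ((htend.eventually_ge_atTop _).filter_mono inf_le_left)
  exact ⟨u, hu, fun w hw => h hw⟩

/-- First-order convexity of the Bregman distance in its dual argument. -/
theorem gap_le_gap_add_inner (hlam : 0 < lam) (x v w : E n) :
    gap lam x v ≤ gap lam x w + inner ℝ (softShrink lam v - x) (v - w) := by
  have h1 := inner_softShrink hlam v
  have h2 := inner_add_sq_le hlam w (softShrink lam v)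
  have h3 := sq_nonneg ‖softShrink lam v - softShrink lam w‖
  rw [gap, gap, inner_sub_left, inner_sub_right, inner_sub_right, real_inner_comm v (softShrink lam v),
    real_inner_comm w (softShrink lam v), real_inner_comm v x, real_inner_comm w x]
  linarith

end Shrinkage

/-! ### Duality, error bound and deterministic iterates -/

section Kaczmarz

variable {m n : ℕ} {lam : ℝ}

theorem mulVec_apply_eq_inner (A : Matrix (Fin m) (Fin n) ℝ) (x : E n) (i : Fin m) :
    A.mulVec x i = inner ℝ (row A i) x := by
  rw [inner_eq_sum_mul]
  rfl

/-- The linear combination of the rows of `A` with coefficients `y`, that is, `Aᵀ y`. -/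
noncomputable def rowComb (A : Matrix (Fin m) (Fin n) ℝ) : EuclideanSpace ℝ (Fin m) →L[ℝ] E n :=
  ∑ i, (EuclideanSpace.proj i : EuclideanSpace ℝ (Fin m) →L[ℝ] ℝ).smulRight (row A i)

theorem rowComb_apply (A : Matrix (Fin m) (Fin n) ℝ) (y : EuclideanSpace ℝ (Fin m)) :
    rowComb A y = ∑ i, y i • row A i := by
  simp [rowComb]

theorem row_mem_range (A : Matrix (Fin m) (Fin n) ℝ) (i : Fin m) :
    row A i ∈ LinearMap.range (rowComb A).toLinearMap := by
  refine ⟨EuclideanSpace.single i 1, ?_⟩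
  simp [rowComb_apply]

theorem inner_rowComb (A : Matrix (Fin m) (Fin n) ℝ) (x : E n) (y : EuclideanSpace ℝ (Fin m)) :
    inner ℝ x (rowComb A y) = ∑ i, y i * inner ℝ (row A i) x := by
  simp [rowComb_apply, inner_sum, real_inner_smul_right, real_inner_comm]

theorem inner_rowComb_le (A : Matrix (Fin m) (Fin n) ℝ) (x : E n)
    (y : EuclideanSpace ℝ (Fin m)) :
    inner ℝ x (rowComb A y) ≤ Real.sqrt (∑ i, inner ℝ (row A i) x ^ 2) * ‖y‖ := by
  rw [inner_rowComb, mul_comm, EuclideanSpace.norm_eq]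
  simpa using Real.sum_mul_le_sqrt_mul_sqrt Finset.univ (fun i => y i)
    (fun i => inner ℝ (row A i) x)

/-- A dual certificate: a point in the range of `Aᵀ` whose shrinkage is feasible. -/
theorem exists_rowComb_feasible (A : Matrix (Fin m) (Fin n) ℝ) {b : Fin m → ℝ}
    (hb : b ∈ Set.range A.mulVec) (hlam : 0 < lam) :
    ∃ y, A.mulVec (softShrink lam (rowComb A y)) = b := by
  obtain ⟨x0, rfl⟩ := hb
  obtain ⟨v, ⟨y, rfl⟩, hv⟩ := exists_forall_gap_le hlam (WithLp.toLp 2 x0) 0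
    (LinearMap.range (rowComb A).toLinearMap)
  refine ⟨y, funext fun i => ?_⟩
  simp only [zero_add] at hv
  set v := (rowComb A).toLinearMap y with hvdef
  change A.mulVec (softShrink lam v) i = A.mulVec (WithLp.toLp 2 x0 : E n) i
  rw [mulVec_apply_eq_inner, mulVec_apply_eq_inner, ← sub_eq_zero, ← inner_sub_right]
  -- A Kaczmarz step from the minimizer stays in the range of Aᵀ and cannot lower the gap, so its
  -- guaranteed decrease, and with it the residual, vanishes.
  have h1 := gap_sub_smul_le hlam (WithLp.toLp 2 x0) v (row A i)
  have h2 := hv _ (Submodule.sub_mem _ ⟨y, rfl⟩ (Submodule.smul_mem _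
    (inner ℝ (row A i) (softShrink lam v - WithLp.toLp 2 x0) / ‖row A i‖ ^ 2) (row_mem_range A i)))
  rcases eq_or_ne (row A i) 0 with h0 | h0
  · rw [h0, inner_zero_left]
  have hn : 0 < ‖row A i‖ ^ 2 := by positivity
  have h3 : inner ℝ (row A i) (softShrink lam v - WithLp.toLp 2 x0) ^ 2 / ‖row A i‖ ^ 2 ≤ 0 := by
    linarith
  rw [div_le_iff₀ hn, zero_mul] at h3
  exact pow_eq_zero_iff two_ne_zero |>.mp (le_antisymm h3 (sq_nonneg _))

/-- A vector in the range of Aᵀ has the same inner product with all feasible points, so the linear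
terms of the strong Fenchel inequality cancel; the quadratic term gives uniqueness. -/
theorem objective_add_sq_le {A : Matrix (Fin m) (Fin n) ℝ} {b : Fin m → ℝ} (hlam : 0 < lam)
    {y : EuclideanSpace ℝ (Fin m)} (hy : A.mulVec (softShrink lam (rowComb A y)) = b)
    {z : E n} (hz : A.mulVec z = b) :
    objective lam (softShrink lam (rowComb A y)) +
      1 / 2 * ‖z - softShrink lam (rowComb A y)‖ ^ 2 ≤ objective lam z := by
  have h1 := inner_add_sq_le hlam (rowComb A y) z
  have h2 := inner_softShrink hlam (rowComb A y)
  have h3 : inner ℝ (rowComb A y) z = inner ℝ (rowComb A y) (softShrink lam (rowComb A y)) := by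
    rw [real_inner_comm, inner_rowComb, real_inner_comm, inner_rowComb]
    simp only [← mulVec_apply_eq_inner, hy, hz]
  linarith

theorem isSolution_softShrink {A : Matrix (Fin m) (Fin n) ℝ} {b : Fin m → ℝ} (hlam : 0 < lam)
    {y : EuclideanSpace ℝ (Fin m)} (hy : A.mulVec (softShrink lam (rowComb A y)) = b) :
    IsSolution A b lam (softShrink lam (rowComb A y)) :=
  ⟨hy, fun z hz => by
    nlinarith [objective_add_sq_le hlam hy hz,
      sq_nonneg ‖z - softShrink lam (rowComb A y)‖]⟩

theorem IsSolution.eq_softShrink {A : Matrix (Fin m) (Fin n) ℝ} {b : Fin m → ℝ} (hlam : 0 < lam)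
    {y : EuclideanSpace ℝ (Fin m)} (hy : A.mulVec (softShrink lam (rowComb A y)) = b)
    {z : E n} (hz : IsSolution A b lam z) : z = softShrink lam (rowComb A y) := by
  have h1 := objective_add_sq_le hlam hy hz.1
  have h2 := hz.2 _ hy
  have h3 : ‖z - softShrink lam (rowComb A y)‖ ^ 2 = 0 :=
    le_antisymm (by linarith) (sq_nonneg _)
  rwa [pow_eq_zero_iff two_ne_zero, norm_eq_zero, sub_eq_zero] at h3

/-- The dual points in the range of `Aᵀ` whose shrinkage is `x` form a polyhedron, and the distance
to it is controlled by the distance of the shrinkages. -/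
theorem exists_dual_error_bound (A : Matrix (Fin m) (Fin n) ℝ) (hlam : 0 < lam) {x : E n}
    (hx : ∃ y, softShrink lam (rowComb A y) = x) :
    ∃ C ≥ 0, ∀ y, ∃ w, softShrink lam (rowComb A w) = x ∧
      ‖y - w‖ ≤ C * ‖softShrink lam (rowComb A y) - x‖ := by
  let ℓ : Fin n ⊕ Fin n → EuclideanSpace ℝ (Fin m) →L[ℝ] ℝ := Sum.elim
    (fun j => (EuclideanSpace.proj j : E n →L[ℝ] ℝ).comp (rowComb A))
    (fun j => -(EuclideanSpace.proj j : E n →L[ℝ] ℝ).comp (rowComb A))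
  let β : Fin n ⊕ Fin n → ℝ := Sum.elim (fun j => subdiffMax lam (x j))
    (fun j => subdiffMax lam (-x j))
  have hiff : ∀ y, (∀ j, ℓ j y ≤ β j) ↔ softShrink lam (rowComb A y) = x := fun y => by
    rw [Sum.forall, ← forall_and, PiLp.ext_iff]
    exact forall_congr' fun j => (shrink_eq_iff hlam (rowComb A y j) (x j)).symm
  obtain ⟨C, hC, h⟩ := hoffman_error_bound ℓ β (hx.imp fun y hy => (hiff y).mpr hy)
  -- The factor 2 counts the upper and the lower constraint of each coordinate.
  refine ⟨C * ∑ j, 2 * (1 + 2 * lam / |x j|), by positivity, fun y => ?_⟩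
  obtain ⟨w, hw, hyw⟩ := h y
  refine ⟨w, (hiff w).mp hw, hyw.trans ?_⟩
  rw [mul_assoc]
  refine mul_le_mul_of_nonneg_left ?_ hC
  rw [Fintype.sum_sum_type, ← Finset.sum_add_distrib, Finset.sum_mul]
  refine Finset.sum_le_sum fun j _ => ?_
  have h1 := max_sub_subdiffMax_le hlam (rowComb A y j) (x j)
  have h2 := max_sub_subdiffMax_le hlam (-rowComb A y j) (-x j)
  rw [shrink_neg, abs_neg, ← neg_sub', abs_neg] at h2
  have h3 : |shrink lam (rowComb A y j) - x j| ≤ ‖softShrink lam (rowComb A y) - x‖ :=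
    PiLp.norm_apply_le (softShrink lam (rowComb A y) - x) j
  have h4 : (0 : ℝ) ≤ 1 + 2 * lam / |x j| := by positivity
  have h5 := mul_le_mul_of_nonneg_left h3 h4
  change max (rowComb A y j - subdiffMax lam (x j)) 0 +
    max (-rowComb A y j - subdiffMax lam (-x j)) 0 ≤ _
  linarith

/-- The Bregman distance is bounded by the squared residual, on the range of `Aᵀ`. -/
theorem exists_gap_le_residual (A : Matrix (Fin m) (Fin n) ℝ) (hlam : 0 < lam) {x : E n}
    (hx : ∃ y, softShrink lam (rowComb A y) = x) :
    ∃ C ≥ 0, ∀ y, gap lam x (rowComb A y) ≤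
      C * ∑ i, inner ℝ (row A i) (softShrink lam (rowComb A y) - x) ^ 2 := by
  obtain ⟨C, hC, h⟩ := exists_dual_error_bound A hlam hx
  refine ⟨2 * C ^ 2, by positivity, fun y => ?_⟩
  obtain ⟨w, hw, hyw⟩ := h y
  set d := softShrink lam (rowComb A y) - x with hd
  set R := ∑ i, inner ℝ (row A i) d ^ 2 with hR
  have hR0 : 0 ≤ R := Finset.sum_nonneg fun _ _ => sq_nonneg _
  have h0 : gap lam x (rowComb A w) = 0 := by
    have := inner_softShrink hlam (rowComb A w)
    rw [gap, ← hw]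
    linarith
  have h1 := gap_le_gap_add_inner hlam x (rowComb A y) (rowComb A w)
  rw [h0, zero_add, ← map_sub, ← hd] at h1
  have h2 := inner_rowComb_le A d (y - w)
  have h3 := sq_norm_sub_le_gap hlam x (rowComb A y)
  rw [← hd] at h3
  have h4 : gap lam x (rowComb A y) ≤ Real.sqrt R * (C * ‖d‖) :=
    h1.trans (h2.trans (by gcongr))
  have h5 := Real.sq_sqrt hR0
  -- With s = C√R: gap ≤ s‖d‖ ≤ s² + ‖d‖²/4 ≤ s² + gap/2.
  nlinarith [sq_nonneg (‖d‖ - 2 * (C * Real.sqrt R)), sq_nonneg (‖d‖ / 2 - C * Real.sqrt R)]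

/-- When b = A x, the line-search objective and the gap relative to `x` differ by a constant along
the line. -/
theorem exists_isExactStep (A : Matrix (Fin m) (Fin n) ℝ) {b : Fin m → ℝ}
    (hb : b ∈ Set.range A.mulVec) (hlam : 0 < lam) (v : E n) (j : Fin m) :
    ∃ t, IsExactStep A b lam v j t := by
  obtain ⟨x0, rfl⟩ := hb
  obtain ⟨u, hu, h⟩ := exists_forall_gap_le hlam (WithLp.toLp 2 x0) v (ℝ ∙ row A j)
  obtain ⟨t, rfl⟩ := Submodule.mem_span_singleton.mp hu
  refine ⟨-t, fun s => ?_⟩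
  have h1 := h (-s • row A j) (Submodule.smul_mem _ _ (Submodule.mem_span_singleton_self _))
  change _ + -t * A.mulVec (WithLp.toLp 2 x0 : E n) j ≤
    _ + s * A.mulVec (WithLp.toLp 2 x0 : E n) j
  rw [conjugate_objective hlam, conjugate_objective hlam, mulVec_apply_eq_inner]
  simp only [gap, inner_add_left, real_inner_smul_left] at h1
  simp only [sub_eq_add_neg, ← neg_smul, neg_neg]
  linarith

theorem IsExactStep.gap_le {A : Matrix (Fin m) (Fin n) ℝ} {x : E n} (hlam : 0 < lam)
    {v : E n} {j : Fin m} {t : ℝ} (ht : IsExactStep A (A.mulVec x) lam v j t) (s : ℝ) :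
    gap lam x (v - t • row A j) ≤ gap lam x (v - s • row A j) := by
  have h := ht s
  rw [conjugate_objective hlam, conjugate_objective hlam, mulVec_apply_eq_inner] at h
  simp only [gap, inner_sub_left, real_inner_smul_left]
  linarith

theorem stepDual_eq_sum (A : Matrix (Fin m) (Fin n) ℝ) (i : ℕ → Fin m) (t : ℕ → ℝ) (k : ℕ) :
    stepDual A i t k = -∑ l : Fin k, t l • row A (i l) := by
  rw [Fin.sum_univ_eq_sum_range (fun l => t l • row A (i l))]
  induction k with
  | zero => simp [stepDual]
  | succ k ih => rw [stepDual, ih, Finset.sum_range_succ]; abel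

theorem stepDual_mem_range (A : Matrix (Fin m) (Fin n) ℝ) (i : ℕ → Fin m) (t : ℕ → ℝ) (k : ℕ) :
    ∃ y, stepDual A i t k = rowComb A y := by
  have : stepDual A i t k ∈ LinearMap.range (rowComb A).toLinearMap := by
    rw [stepDual_eq_sum]
    exact Submodule.neg_mem _ (Submodule.sum_mem _ fun l _ =>
      Submodule.smul_mem _ _ (row_mem_range A _))
  obtain ⟨y, hy⟩ := this
  exact ⟨y, hy.symm⟩

theorem rskDual_eq_stepDual (A : Matrix (Fin m) (Fin n) ℝ) (b : Fin m → ℝ) (i : ℕ → Fin m)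
    (k : ℕ) :
    rskDual A b lam i k = stepDual A i (fun l => (inner ℝ (row A (i l))
      (softShrink lam (rskDual A b lam i l)) - b (i l)) / ‖row A (i l)‖ ^ 2) k := by
  induction k with
  | zero => rfl
  | succ k ih => rw [rskDual, stepDual, ← ih]

theorem rskDual_congr (A : Matrix (Fin m) (Fin n) ℝ) (b : Fin m → ℝ) {i i' : ℕ → Fin m} {k : ℕ}
    (h : ∀ l < k, i l = i' l) : rskDual A b lam i k = rskDual A b lam i' k := by
  induction k with
  | zero => rfl
  | succ k ih =>
    rw [rskDual, rskDual, ih fun l hl => h l (Nat.lt_succ_of_lt hl), h k (Nat.lt_succ_self k)]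

end Kaczmarz

end SparseKaczmarz

/-! ### Averaging over an independent index -/

section IndependentIndex

/-- A finitely valued random index can be averaged out of a function of it and an independent
random variable. -/
theorem integral_indep_index_eq_sum {Ω S ι : Type*} [MeasurableSpace Ω] [MeasurableSpace S]
    [Fintype ι] [MeasurableSpace ι] [MeasurableSingletonClass ι] {P : Measure Ω}
    {X : Ω → ι} {Y : Ω → S} (hX : Measurable X) (hY : Measurable Y) (hXY : IndepFun X Y P)
    {h : ι → S → ℝ} (hh : ∀ j, Measurable (h j)) (hint : ∀ j, Integrable (fun ω => h j (Y ω)) P) :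
    Integrable (fun ω => h (X ω) (Y ω)) P ∧
    ∫ ω, h (X ω) (Y ω) ∂P = ∑ j, P.real {ω | X ω = j} * ∫ ω, h j (Y ω) ∂P := by
  classical
  let e : ι → ι → ℝ := fun j => ({j} : Set ι).indicator 1
  have he : ∀ j, Measurable (e j) := fun j => measurable_one.indicator (measurableSet_singleton j)
  have hset : ∀ j, MeasurableSet {ω | X ω = j} := fun j => hX (measurableSet_singleton j)
  have hprod : ∀ j, Integrable (fun ω => e j (X ω) * h j (Y ω)) P := fun j => by
    refine (hint j).bdd_mul (c := 1) ((he j).comp hX).aestronglyMeasurable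
      (Eventually.of_forall fun ω => ?_)
    by_cases hj : X ω = j <;> simp [e, hj]
  -- Splitting by the value of the index turns each term into a product of independent factors.
  have hsum : (fun ω => h (X ω) (Y ω)) = fun ω => ∑ j, e j (X ω) * h j (Y ω) := by
    funext ω
    simp [e, Pi.single_apply]
  rw [hsum]
  refine ⟨integrable_finsetSum _ fun j _ => hprod j, ?_⟩
  rw [integral_finsetSum _ fun j _ => hprod j]
  refine Finset.sum_congr rfl fun j _ => ?_
  have hind : IndepFun (fun ω => e j (X ω)) (fun ω => h j (Y ω)) P := hXY.comp (he j) (hh j)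
  rw [hind.integral_fun_mul_eq_mul_integral ((he j).comp hX).aestronglyMeasurable
    ((hh j).comp hY).aestronglyMeasurable, ← integral_indicator_one (hset j)]
  rfl

theorem sq_integral_le_integral_sq {Ω : Type*} [MeasurableSpace Ω] {P : Measure Ω}
    [IsProbabilityMeasure P] {X : Ω → ℝ} (hX : MemLp X 2 P) :
    (∫ ω, X ω ∂P) ^ 2 ≤ ∫ ω, X ω ^ 2 ∂P := by
  have h1 := variance_nonneg X P
  rw [variance_eq_sub hX] at h1
  simpa using h1

end IndependentIndex

namespace SparseKaczmarz

/-! ### Expected linear rate -/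

section Rate

variable {m n : ℕ} {lam : ℝ}

/-- The guaranteed decrease of the Bregman distance (up to a factor `2`) of a step at `v` along
row `j`. -/
noncomputable def decrease (A : Matrix (Fin m) (Fin n) ℝ) (lam : ℝ) (x : E n) (j : Fin m)
    (v : E n) : ℝ :=
  inner ℝ (row A j) (softShrink lam v - x) ^ 2 / ‖row A j‖ ^ 2

theorem decrease_nonneg (A : Matrix (Fin m) (Fin n) ℝ) (x : E n) (j : Fin m) (v : E n) :
    0 ≤ decrease A lam x j v := by
  unfold decrease
  positivity

/-- The gap after a Kaczmarz step is still nonnegative. Integrability of the decrease follows from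
this. -/
theorem decrease_le_gap (A : Matrix (Fin m) (Fin n) ℝ) (hlam : 0 < lam) (x : E n) (j : Fin m)
    (v : E n) : decrease A lam x j v ≤ 2 * gap lam x v := by
  have h1 := gap_sub_smul_le hlam x v (row A j)
  have h2 := (gap_nonneg hlam x _).trans h1
  unfold decrease
  linarith

theorem continuous_decrease (A : Matrix (Fin m) (Fin n) ℝ) (hlam : 0 < lam) (x : E n)
    (j : Fin m) : Continuous (decrease A lam x j) := by
  have := continuous_softShrink (n := n) hlam
  unfold decrease
  fun_prop

/-- Zero rows contribute nothing to either side; for the others the sum of the ratios bounds each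
ratio. -/
theorem sum_sq_inner_row_le (A : Matrix (Fin m) (Fin n) ℝ) {p : Fin m → ℝ} (hp : ∀ i, 0 < p i)
    (x v : E n) :
    ∑ i, inner ℝ (row A i) (softShrink lam v - x) ^ 2 ≤
      (∑ i, ‖row A i‖ ^ 2 / p i) * ∑ i, p i * decrease A lam x i v := by
  rw [Finset.mul_sum]
  refine Finset.sum_le_sum fun i _ => ?_
  have h1 : inner ℝ (row A i) (softShrink lam v - x) ^ 2 =
      ‖row A i‖ ^ 2 / p i * (p i * decrease A lam x i v) := by
    unfold decrease
    rcases eq_or_ne (row A i) 0 with h0 | h0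
    · simp [h0]
    · have h2 : ‖row A i‖ ≠ 0 := norm_ne_zero_iff.mpr h0
      have h3 := (hp i).ne'
      field_simp
  rw [h1]
  refine mul_le_mul_of_nonneg_right ?_ (mul_nonneg (hp i).le (decrease_nonneg A x i v))
  exact Finset.single_le_sum (f := fun i => ‖row A i‖ ^ 2 / p i)
    (fun i _ => div_nonneg (sq_nonneg _) (hp i).le) (Finset.mem_univ i)

/-- On the range of `Aᵀ`, the expected decrease is at least a fixed fraction of the Bregman
distance. -/
theorem exists_gap_le_sum_decrease (A : Matrix (Fin m) (Fin n) ℝ) (hlam : 0 < lam) {x : E n}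
    (hx : ∃ y, softShrink lam (rowComb A y) = x) {p : Fin m → ℝ} (hp : ∀ i, 0 < p i) :
    ∃ N > 1, ∀ y, gap lam x (rowComb A y) ≤
      N * (1 / 2 * ∑ i, p i * decrease A lam x i (rowComb A y)) := by
  obtain ⟨C, hC, h⟩ := exists_gap_le_residual A hlam hx
  have hM : 0 ≤ ∑ i, ‖row A i‖ ^ 2 / p i :=
    Finset.sum_nonneg fun i _ => div_nonneg (sq_nonneg _) (hp i).le
  -- The factor 2 absorbs the ½, and adding 2 forces N > 1, so that 1 - 1/N is positive.
  refine ⟨2 * (C * ∑ i, ‖row A i‖ ^ 2 / p i) + 2, by nlinarith [mul_nonneg hC hM], fun y => ?_⟩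
  have h1 := mul_le_mul_of_nonneg_left (sum_sq_inner_row_le (lam := lam) A hp x (rowComb A y)) hC
  have h2 : 0 ≤ ∑ i, p i * decrease A lam x i (rowComb A y) :=
    Finset.sum_nonneg fun i _ => mul_nonneg (hp i).le (decrease_nonneg A x i _)
  nlinarith [h y]

/-- Independence replaces the random row by its `p`-average, which the error bound compares with the
gap; thus the expected decrease is at least 1/N of the expected gap. -/
theorem integral_gap_succ_le (A : Matrix (Fin m) (Fin n) ℝ) (hlam : 0 < lam) {x : E n}
    {p : Fin m → ℝ} {N : ℝ} (hN : 1 < N)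
    (hgap : ∀ y, gap lam x (rowComb A y) ≤
      N * (1 / 2 * ∑ i, p i * decrease A lam x i (rowComb A y)))
    {Ω : Type*} [MeasurableSpace Ω] {P : Measure Ω} {i : Ω → Fin m} {V V' : Ω → E n}
    (hi : Measurable i) (hV : Measurable V) (hlaw : ∀ j, P.real {ω | i ω = j} = p j)
    (hind : IndepFun i V P) (hrange : ∀ ω, ∃ y, V ω = rowComb A y)
    (hint : Integrable (fun ω => gap lam x (V ω)) P)
    (hint' : Integrable (fun ω => gap lam x (V' ω)) P)
    (hstep : ∀ᵐ ω ∂P, gap lam x (V' ω) ≤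
      gap lam x (V ω) - 1 / 2 * decrease A lam x (i ω) (V ω)) :
    ∫ ω, gap lam x (V' ω) ∂P ≤ (1 - N⁻¹) * ∫ ω, gap lam x (V ω) ∂P := by
  have hmeas : ∀ j, Measurable (decrease A lam x j) := fun j =>
    (continuous_decrease A hlam x j).measurable
  have hdec : ∀ j, Integrable (fun ω => decrease A lam x j (V ω)) P := fun j => by
    refine (hint.const_mul 2).mono' ((hmeas j).comp hV).aestronglyMeasurable
      (Eventually.of_forall fun ω => ?_)
    rw [Real.norm_of_nonneg (decrease_nonneg A x j _)]
    exact decrease_le_gap A hlam x j _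
  obtain ⟨hI, hE⟩ := integral_indep_index_eq_sum hi hV hind hmeas hdec
  have hsum : ∫ ω, gap lam x (V ω) ∂P ≤
      N * (1 / 2 * ∫ ω, decrease A lam x (i ω) (V ω) ∂P) := by
    calc ∫ ω, gap lam x (V ω) ∂P
        ≤ ∫ ω, N * (1 / 2 * ∑ j, p j * decrease A lam x j (V ω)) ∂P := by
          refine integral_mono hint (((integrable_finsetSum _ fun j _ =>
            (hdec j).const_mul (p j)).const_mul _).const_mul _) fun ω => ?_
          obtain ⟨y, hy⟩ := hrange ω
          simpa only [hy] using hgap y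
      _ = N * (1 / 2 * ∫ ω, decrease A lam x (i ω) (V ω) ∂P) := by
          rw [integral_const_mul, integral_const_mul,
            integral_finsetSum _ fun j _ => (hdec j).const_mul (p j), hE]
          simp only [integral_const_mul, hlaw]
  have hle : ∫ ω, gap lam x (V' ω) ∂P ≤
      ∫ ω, gap lam x (V ω) ∂P - 1 / 2 * ∫ ω, decrease A lam x (i ω) (V ω) ∂P := by
    rw [← integral_const_mul, ← integral_sub hint (hI.const_mul _)]
    exact integral_mono_ae hint' (hint.sub (hI.const_mul _)) hstep
  rw [← div_le_iff₀' (by linarith : (0 : ℝ) < N), div_eq_inv_mul] at hsum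
  linarith

/-- Expected linear convergence of every randomized method whose dual iterates stay in the range
of `Aᵀ` and whose steps decrease the Bregman distance at least as much as a Kaczmarz step. -/
theorem exists_convergesAtRate (A : Matrix (Fin m) (Fin n) ℝ) (hlam : 0 < lam) {x : E n}
    (hx : ∃ y, softShrink lam (rowComb A y) = x) {p : Fin m → ℝ} (hp : ∀ i, 0 < p i) :
    ∃ q ∈ Set.Ioo (0 : ℝ) 1, ∃ c > (0 : ℝ),
      ∀ (Ω : Type u) [MeasurableSpace Ω] (P : Measure Ω) [IsProbabilityMeasure P]
        (i : ℕ → Ω → Fin m) (V : ℕ → Ω → E n),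
        (∀ k, Measurable (i k)) → (∀ k, Measurable (V k)) →
        (∀ k j, P.real {ω | i k ω = j} = p j) → (∀ k, IndepFun (i k) (V k) P) →
        (∀ ω, V 0 ω = 0) → (∀ k ω, ∃ y, V k ω = rowComb A y) →
        (∀ᵐ ω ∂P, ∀ k, gap lam x (V (k + 1) ω) ≤
          gap lam x (V k ω) - 1 / 2 * decrease A lam x (i k ω) (V k ω)) →
        ConvergesAtRate P (fun k ω => softShrink lam (V k ω)) x c q := by
  obtain ⟨N, hN, hgap⟩ := exists_gap_le_sum_decrease A hlam hx hp
  have hq0 : 0 < 1 - N⁻¹ := sub_pos.mpr (inv_lt_one_of_one_lt₀ hN)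
  have hq1 : 1 - N⁻¹ < 1 := sub_lt_self _ (inv_pos.mpr (by linarith))
  have hG : 0 ≤ gap lam x 0 := gap_nonneg hlam x 0
  -- Adding 1 keeps the constant positive even if the initial gap is zero.
  refine ⟨1 - N⁻¹, ⟨hq0, hq1⟩, Real.sqrt (2 * gap lam x 0) + 1, by positivity, ?_⟩
  intro Ω _ P _ i V hi hV hlaw hind h0 hrange hstep
  -- The gap never increases along almost every run, so its deterministic initial value bounds it
  -- and makes it integrable.
  have hbdd : ∀ᵐ ω ∂P, ∀ k, gap lam x (V k ω) ≤ gap lam x 0 := by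
    filter_upwards [hstep] with ω hω k
    induction k with
    | zero => rw [h0]
    | succ k ih => linarith [hω k, decrease_nonneg (lam := lam) A x (i k ω) (V k ω)]
  have hint : ∀ k, Integrable (fun ω => gap lam x (V k ω)) P := fun k => by
    refine Integrable.of_bound ((continuous_gap hlam x).measurable.comp (hV k)).aestronglyMeasurable
      (gap lam x 0) ?_
    filter_upwards [hbdd] with ω hω
    rw [Real.norm_of_nonneg (gap_nonneg hlam x _)]
    exact hω k
  have hdecay : ∀ k, ∫ ω, gap lam x (V k ω) ∂P ≤ gap lam x 0 * (1 - N⁻¹) ^ k := fun k => by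
    induction k with
    | zero => simp [h0]
    | succ k ih =>
      calc _ ≤ (1 - N⁻¹) * ∫ ω, gap lam x (V k ω) ∂P :=
            integral_gap_succ_le A hlam hN hgap (hi k) (hV k) (hlaw k) (hind k) (hrange k)
              (hint k) (hint (k + 1)) (hstep.mono fun ω hω => hω k)
        _ ≤ (1 - N⁻¹) * (gap lam x 0 * (1 - N⁻¹) ^ k) := by gcongr
        _ = _ := by ring
  have hmeas : ∀ k, Measurable fun ω => ‖softShrink lam (V k ω) - x‖ := fun k =>
    (((continuous_softShrink hlam).measurable.comp (hV k)).sub_const x).norm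
  have hsq : ∀ k ω, ‖softShrink lam (V k ω) - x‖ ^ 2 ≤ 2 * gap lam x (V k ω) := fun k ω => by
    linarith [sq_norm_sub_le_gap hlam x (V k ω)]
  have hintsq : ∀ k, Integrable (fun ω => ‖softShrink lam (V k ω) - x‖ ^ 2) P := fun k => by
    refine ((hint k).const_mul 2).mono' ((hmeas k).pow_const 2).aestronglyMeasurable
      (Eventually.of_forall fun ω => ?_)
    rw [Real.norm_of_nonneg (sq_nonneg _)]
    exact hsq k ω
  have hLp : ∀ k, MemLp (fun ω => ‖softShrink lam (V k ω) - x‖) 2 P := fun k =>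
    (memLp_two_iff_integrable_sq (hmeas k).aestronglyMeasurable).mpr (hintsq k)
  have hrate : ∀ k : ℕ, ∫ ω, ‖softShrink lam (V k ω) - x‖ ∂P ≤
      (Real.sqrt (2 * gap lam x 0) + 1) * (1 - N⁻¹) ^ ((k : ℝ) / 2) := fun k => by
    have h1 : (∫ ω, ‖softShrink lam (V k ω) - x‖ ∂P) ^ 2 ≤ 2 * gap lam x 0 * (1 - N⁻¹) ^ k := by
      calc _ ≤ ∫ ω, ‖softShrink lam (V k ω) - x‖ ^ 2 ∂P := sq_integral_le_integral_sq (hLp k)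
        _ ≤ ∫ ω, 2 * gap lam x (V k ω) ∂P :=
          integral_mono (hintsq k) ((hint k).const_mul 2) (hsq k)
        _ = 2 * ∫ ω, gap lam x (V k ω) ∂P := integral_const_mul _ _
        _ ≤ _ := by linarith [hdecay k]
    have h2 : (1 - N⁻¹) ^ ((k : ℝ) / 2) = Real.sqrt ((1 - N⁻¹) ^ k) := by
      rw [Real.sqrt_eq_rpow, ← Real.rpow_natCast, ← Real.rpow_mul hq0.le]
      ring_nf
    have h3 := Real.le_sqrt_of_sq_le h1
    rw [Real.sqrt_mul (by positivity)] at h3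
    rw [h2]
    nlinarith [Real.sqrt_nonneg ((1 - N⁻¹) ^ k)]
  refine ⟨fun k => (hLp k).integrable one_le_two, hrate, ?_⟩
  refine squeeze_zero (fun k => integral_nonneg fun ω => norm_nonneg _) hrate ?_
  rw [← mul_zero (Real.sqrt (2 * gap lam x 0) + 1)]
  refine Tendsto.const_mul _ ?_
  exact (tendsto_rpow_atTop_of_base_lt_one _ (by linarith) hq1).comp
    (tendsto_natCast_atTop_atTop.atTop_div_const two_pos)

end Rate

/-! ### The two methods as instances -/

section Methods

variable {m n : ℕ} {lam : ℝ}

theorem gap_rskDual_succ_le (A : Matrix (Fin m) (Fin n) ℝ) (hlam : 0 < lam) (x : E n)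
    (i : ℕ → Fin m) (k : ℕ) :
    gap lam x (rskDual A (A.mulVec x) lam i (k + 1)) ≤
      gap lam x (rskDual A (A.mulVec x) lam i k) -
        1 / 2 * decrease A lam x (i k) (rskDual A (A.mulVec x) lam i k) := by
  rw [rskDual, mulVec_apply_eq_inner, ← inner_sub_right]
  exact gap_sub_smul_le hlam x _ _

theorem IsErskRun.gap_stepDual_succ_le {A : Matrix (Fin m) (Fin n) ℝ} (hlam : 0 < lam) {x : E n}
    {i : ℕ → Fin m} {t : ℕ → ℝ} (h : IsErskRun A (A.mulVec x) lam i t) (k : ℕ) :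
    gap lam x (stepDual A i t (k + 1)) ≤
      gap lam x (stepDual A i t k) - 1 / 2 * decrease A lam x (i k) (stepDual A i t k) :=
  ((h k).gap_le hlam _).trans (gap_sub_smul_le hlam x _ _)

/-- The RSK dual iterate is a function of the earlier row indices. -/
theorem exists_rskDual_eq_comp [Nonempty (Fin m)] (A : Matrix (Fin m) (Fin n) ℝ) (b : Fin m → ℝ)
    (lam : ℝ) (k : ℕ) : ∃ F : (Finset.range k → Fin m) → E n, Measurable F ∧
      ∀ i : ℕ → Fin m, rskDual A b lam i k = F fun l => i l := by
  classical
  refine ⟨fun j => rskDual A b lam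
    (fun l => if h : l ∈ Finset.range k then j ⟨l, h⟩ else Classical.arbitrary _) k,
    measurable_of_finite _, fun i => rskDual_congr A b fun l hl => ?_⟩
  rw [dif_pos (Finset.mem_range.mpr hl)]

/-- The dual iterate is a measurable function of the earlier row indices and step sizes. -/
theorem exists_stepDual_eq_comp (A : Matrix (Fin m) (Fin n) ℝ) (k : ℕ) :
    ∃ F : (Fin k → Fin m × ℝ) → E n, Measurable F ∧
      ∀ (i : ℕ → Fin m) (t : ℕ → ℝ), stepDual A i t k = F fun l => (i l, t l) := by
  refine ⟨fun z => -∑ l, (z l).2 • row A (z l).1, ?_, fun i t => stepDual_eq_sum A i t k⟩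
  have : Measurable (row A) := measurable_of_finite _
  fun_prop

end Methods

end SparseKaczmarz

theorem mainTheorem1 {m n : ℕ} (A : Matrix (Fin m) (Fin n) ℝ) (b : Fin m → ℝ)
    (hb : b ∈ Set.range A.mulVec) (lam : ℝ) (hlam : 0 < lam)
    (p : Fin m → ℝ) (hp : ∀ i, 0 < p i) (hp_sum : ∑ i, p i = 1) :
    ∃ xhat : SparseKaczmarz.E n,
      -- `xhat` is the unique solution of the regularized basis pursuit problem
      SparseKaczmarz.IsSolution A b lam xhat ∧
      (∀ y, SparseKaczmarz.IsSolution A b lam y → y = xhat) ∧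
      -- RSK: independent row indices, row `j` being drawn with probability `p j`
      (∃ q ∈ Set.Ioo (0 : ℝ) 1, ∃ c > (0 : ℝ),
        ∀ (Ω : Type u) [MeasurableSpace Ω] (P : Measure Ω) [IsProbabilityMeasure P]
          (idx : ℕ → Ω → Fin m),
          (∀ k, Measurable (idx k)) →
          (∀ k j, P.real {ω | idx k ω = j} = p j) →
          iIndepFun idx P →
          SparseKaczmarz.ConvergesAtRate P
            (fun k ω => SparseKaczmarz.rsk A b lam (fun l => idx l ω) k) xhat c q) ∧
      -- ERSK: exact step sizes exist at every point
      (∀ (v : SparseKaczmarz.E n) (j : Fin m),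
        ∃ t : ℝ, SparseKaczmarz.IsExactStep A b lam v j t) ∧
      -- ERSK: each row index is drawn independently of all earlier row indices and step sizes
      (∃ q ∈ Set.Ioo (0 : ℝ) 1, ∃ c > (0 : ℝ),
        ∀ (Ω : Type u) [MeasurableSpace Ω] (P : Measure Ω) [IsProbabilityMeasure P]
          (idx : ℕ → Ω → Fin m) (t : ℕ → Ω → ℝ),
          (∀ k, Measurable (idx k)) →
          (∀ k, Measurable (t k)) →
          (∀ k j, P.real {ω | idx k ω = j} = p j) →
          (∀ k, IndepFun (idx k) (fun ω (l : Fin k) => (idx l ω, t l ω)) P) →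
          (∀ᵐ ω ∂P, SparseKaczmarz.IsErskRun A b lam (fun l => idx l ω) (fun l => t l ω)) →
          SparseKaczmarz.ConvergesAtRate P
            (fun k ω => SparseKaczmarz.ersk A lam (fun l => idx l ω) (fun l => t l ω) k)
            xhat c q) := by
  obtain ⟨y, hy⟩ := SparseKaczmarz.exists_rowComb_feasible A hb hlam
  refine ⟨_, SparseKaczmarz.isSolution_softShrink hlam hy,
    fun z hz => hz.eq_softShrink hlam hy, ?_, SparseKaczmarz.exists_isExactStep A hb hlam, ?_⟩
  · obtain ⟨q, hq, c, hc, h⟩ := SparseKaczmarz.exists_convergesAtRate A hlam ⟨y, rfl⟩ hp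
    refine ⟨q, hq, c, hc, fun Ω _ P _ idx hidx hlaw hind => ?_⟩
    -- The gap lemmas need the right-hand side in the form A x with x the solution.
    subst hy
    have : Nonempty (Fin m) := (nonempty_of_isProbabilityMeasure P).map (idx 0)
    choose F hF hdual using SparseKaczmarz.exists_rskDual_eq_comp A
      (A.mulVec (SparseKaczmarz.softShrink lam (SparseKaczmarz.rowComb A y))) lam
    refine h Ω P idx (fun k ω => SparseKaczmarz.rskDual A _ lam (fun l => idx l ω) k) hidx
      (fun k => ?_) hlaw (fun k => ?_) (fun _ => rfl) (fun k ω => ?_)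
      (Filter.Eventually.of_forall fun ω => SparseKaczmarz.gap_rskDual_succ_le A hlam _ _)
    · simp only [hdual]
      exact (hF k).comp (measurable_pi_lambda _ fun l => hidx l)
    · simp only [hdual]
      -- The iterate at time `k` uses only the indices before `k`, a set disjoint from {k}.
      exact (hind.indepFun_finset {k} (Finset.range k) (by simp) hidx).comp
        (measurable_pi_apply (⟨k, by simp⟩ : ({k} : Finset ℕ))) (hF k)
    · obtain ⟨w, hw⟩ := SparseKaczmarz.stepDual_mem_range A (fun l => idx l ω) _ k
      exact ⟨w, (SparseKaczmarz.rskDual_eq_stepDual A _ _ k).trans hw⟩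
  · obtain ⟨q, hq, c, hc, h⟩ := SparseKaczmarz.exists_convergesAtRate A hlam ⟨y, rfl⟩ hp
    refine ⟨q, hq, c, hc, fun Ω _ P _ idx t hidx ht hlaw hind hrun => ?_⟩
    subst hy
    choose F hF hdual using SparseKaczmarz.exists_stepDual_eq_comp A
    refine h Ω P idx (fun k ω => SparseKaczmarz.stepDual A (fun l => idx l ω) (fun l => t l ω) k)
      hidx (fun k => ?_) hlaw (fun k => ?_) (fun _ => rfl)
      (fun k ω => SparseKaczmarz.stepDual_mem_range A _ _ k)
      (hrun.mono fun ω hω => hω.gap_stepDual_succ_le hlam)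
    · simp only [hdual]
      exact (hF k).comp (measurable_pi_lambda _ fun l => (hidx l).prodMk (ht l))
    · simp only [hdual]
      exact (hind k).comp measurable_id (hF k)
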